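/- Consider the alphabet of the nine symbols $[$, $]$, $\to$, $\forall$, $\doteq$, $\in$, $w$, $\prime$, $\bot$. The *variables* are the strings $w\prime\cdots\prime$, that is, $w$ followed by $n\ge 0$ copies of the symbol $\prime$. The *well-formed formulae* of set theory are the strings obtained by the following rules: $\bot$, $x\doteq y$ and $x\in y$ are formulae for all variables $x,y$; if $\varphi$ and $\psi$ are formulae and $x$ is a variable, then $[\varphi\to\psi]$ and $[\forall x]\varphi$ are formulae. A well-formed formula $\varphi$ is *stratified* if there is a function $\sigma$ from the set of variables appearing in $\varphi$ to $\mathbb{Z}$ such that $\sigma(x)=\sigma(y)-1$ whenever $x\in y$ is a subformula of $\varphi$, and $\sigma(x)=\sigma(y)$ whenever $x\doteq y$ is a subformula of $\varphi$. **Theorem.** The set of all stratified well-formed formulae of set theory, a formal language over this nine-symbol alphabet, is not context-free. -/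

import Mathlib

namespace StratSyntax

/-- The nine symbols `[`, `]`, `→`, `∀`, `≐`, `∈`, `w`, `′`, `⊥` of the language of set theory. -/
inductive Symb : Type
  | lbr | rbr | imp | all | eq | mem | w | prime | bot
  deriving DecidableEq

/-- The `n`-th variable: the string `w′…′` with `n` primes. -/
def varStr (n : ℕ) : List Symb := Symb.w :: List.replicate n Symb.prime

/-- Well-formed formulae of set theory, by their formation rules; the number `n` stands for the
variable `varStr n`. Formulae correspond one-to-one to the strings `Formula.str` below, see
`Formula.str_injective`. -/
inductive Formula : Type
  /-- `⊥` -/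
  | bot : Formula
  /-- `x ≐ y` -/
  | eq (x y : ℕ) : Formula
  /-- `x ∈ y` -/
  | mem (x y : ℕ) : Formula
  /-- `[φ → ψ]` -/
  | imp (φ ψ : Formula) : Formula
  /-- `[∀ x] φ` -/
  | all (x : ℕ) (φ : Formula) : Formula

namespace Formula

/-- The string over the nine-symbol alphabet which the formula is. -/
def str : Formula → List Symb
  | bot => [Symb.bot]
  | eq x y => varStr x ++ [Symb.eq] ++ varStr y
  | mem x y => varStr x ++ [Symb.mem] ++ varStr y
  | imp φ ψ => [Symb.lbr] ++ φ.str ++ [Symb.imp] ++ ψ.str ++ [Symb.rbr]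
  | all x φ => [Symb.lbr, Symb.all] ++ varStr x ++ [Symb.rbr] ++ φ.str

/-- The set of subformulae of a formula, the formula itself included. -/
def subformulae : Formula → Set Formula
  | bot => {bot}
  | eq x y => {eq x y}
  | mem x y => {mem x y}
  | imp φ ψ => {imp φ ψ} ∪ φ.subformulae ∪ ψ.subformulae
  | all x φ => {all x φ} ∪ φ.subformulae

/-- `σ` is a stratification of `φ`. Only the values of `σ` at variables that appear in `φ` matter,
so `σ` is taken to be defined on all variables. -/
def IsStratification (σ : ℕ → ℤ) (φ : Formula) : Prop :=
  (∀ x y, mem x y ∈ φ.subformulae → σ x = σ y - 1) ∧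
    (∀ x y, eq x y ∈ φ.subformulae → σ x = σ y)

/-- A formula is stratified if it has a stratification. -/
def IsStratified (φ : Formula) : Prop := ∃ σ : ℕ → ℤ, IsStratification σ φ

end Formula

/-- The formal language of the stratified formulae of set theory. -/
def stratifiedLanguage : Language Symb := {s | ∃ φ : Formula, φ.IsStratified ∧ φ.str = s}

/-- Unique reading of a variable followed by a string that does not start with a prime. -/
theorem varStr_append_inj {m n : ℕ} {s t : List Symb} (hs : s.head? ≠ some Symb.prime)
    (ht : t.head? ≠ some Symb.prime) (h : varStr m ++ s = varStr n ++ t) : m = n ∧ s = t := by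
  induction m generalizing n with
  | zero =>
    cases n with
    | zero => simpa [varStr] using h
    | succ n => simp [varStr, List.replicate_succ] at h; simp [h] at hs
  | succ m ih =>
    cases n with
    | zero => simp [varStr, List.replicate_succ] at h; simp [← h] at ht
    | succ n =>
      have := @ih n (by simpa [varStr, List.replicate_succ] using h)
      exact ⟨by rw [this.1], this.2⟩

/-- Unique readability, in the form needed for the induction. -/
theorem Formula.str_append_inj (φ ψ : Formula) {s t : List Symb} (hs : s.head? ≠ some Symb.prime)
    (ht : t.head? ≠ some Symb.prime) (h : φ.str ++ s = ψ.str ++ t) : φ = ψ ∧ s = t := by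
  have hv : ∀ {s t : List Symb} (a b : Symb) (x y x' y' : ℕ), s.head? ≠ some Symb.prime →
      t.head? ≠ some Symb.prime → a ≠ Symb.prime → b ≠ Symb.prime →
      varStr x ++ (a :: (varStr y ++ s)) = varStr x' ++ (b :: (varStr y' ++ t)) →
      x = x' ∧ a = b ∧ y = y' ∧ s = t := by
    intro s t a b x y x' y' hs ht ha hb h
    obtain ⟨h1, h2⟩ := varStr_append_inj (by simpa using ha) (by simpa using hb) h
    rw [List.cons.injEq] at h2
    obtain ⟨h3, h4⟩ := varStr_append_inj hs ht h2.2
    exact ⟨h1, h2.1, h3, h4⟩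
  have hhead : ∀ (φ : Formula) (u : List Symb), (φ.str ++ u).head? ≠ some Symb.all := by
    intro φ u
    cases φ <;> simp [str, varStr]
  induction φ generalizing ψ s t with
  | bot =>
    cases ψ with
    | bot => simpa [str] using h
    | _ => simp [str, varStr] at h
  | eq x y =>
    cases ψ with
    | eq x' y' =>
      have := hv Symb.eq Symb.eq x y x' y' hs ht (by decide) (by decide) (by simpa [str] using h)
      simp [this]
    | mem x' y' =>
      have := hv Symb.eq Symb.mem x y x' y' hs ht (by decide) (by decide) (by simpa [str] using h)
      simp at this
    | _ => simp [str, varStr] at h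
  | mem x y =>
    cases ψ with
    | eq x' y' =>
      have := hv Symb.mem Symb.eq x y x' y' hs ht (by decide) (by decide) (by simpa [str] using h)
      simp at this
    | mem x' y' =>
      have := hv Symb.mem Symb.mem x y x' y' hs ht (by decide) (by decide) (by simpa [str] using h)
      simp [this]
    | _ => simp [str, varStr] at h
  | imp φ₁ φ₂ ih₁ ih₂ =>
    cases ψ with
    | imp ψ₁ ψ₂ =>
      simp only [str, List.append_assoc, List.cons_append, List.nil_append,
        List.cons.injEq, true_and] at h
      obtain ⟨rfl, h'⟩ := ih₁ ψ₁ (by simp) (by simp) h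
      replace h' := List.tail_eq_of_cons_eq h'
      obtain ⟨rfl, h''⟩ := ih₂ ψ₂ (by simp) (by simp) h'
      simpa using h''
    | all y ψ =>
      simp only [str, List.append_assoc, List.cons_append, List.nil_append,
        List.cons.injEq, true_and] at h
      exact absurd (by rw [h]; rfl) (hhead φ₁ _)
    | _ => simp [str, varStr] at h
  | all x φ ih =>
    cases ψ with
    | imp ψ₁ ψ₂ =>
      simp only [str, List.append_assoc, List.cons_append, List.nil_append,
        List.cons.injEq, true_and] at h
      exact absurd (by rw [← h]; rfl) (hhead ψ₁ _)
    | all y ψ =>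
      simp only [str, List.append_assoc, List.cons_append, List.nil_append,
        List.cons.injEq, true_and] at h
      obtain ⟨rfl, h'⟩ := varStr_append_inj (by simp) (by simp) h
      obtain ⟨rfl, h''⟩ := ih ψ hs ht (List.tail_eq_of_cons_eq h')
      exact ⟨rfl, h''⟩
    | _ => simp [str, varStr] at h

/-- Unique readability: a formula is determined by its string. -/
theorem Formula.str_injective : Function.Injective Formula.str := fun φ ψ h =>
  (Formula.str_append_inj φ ψ (s := []) (t := []) (by simp) (by simp) (by simpa using h)).1

end StratSyntax

/-!
Consider the formulae `[x ∈ w → [w ∈ y → w ∈ z]]`, where `x`, `y`, `z` are variables with `i`, `j`,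
`k` primes (all positive). Such a formula is stratified if and only if `i ≠ j` and `i ≠ k`: a
coincidence forces two opposite memberships, and there is no other constraint that could fail. So a
context-free grammar would have to make sure that `i` differs from `j` and from `k` at the same
time.

Ogden's lemma shows that it cannot. Mark the first block of primes, and take `i` above the constant
of the lemma, `j = i + i!` and `k = i + 2 · i!`. One of the two pumped factors lies in the first
block, so that pumping changes at most one of `j` and `k`; the first block grows in steps that
divide `i!`, so it can be made as long as the block that stays fixed. The pumped string is then in
the language but belongs to a formula that is not stratified.

Pumping might also disturb the rest of the string: the stratified formulae of this shape are only
the intersection of the language with a regular one. To deal with this, Ogden's lemma is proved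
(`ContextFreeGrammar.exists_pump`) with a colouring of words by finitely many colours: the repeated
nonterminal can be chosen such that the words derived from its two occurrences have the same colour
as well. Both the marks and the colours live on words over a larger alphabet that is mapped to the
alphabet of the grammar; here its letters are the eighteen positions in the test formula, with one
letter for each block of primes. The colour records the first and the last letter of a word and
whether neighbouring letters follow one another as in the test formula, so pumped words keep the
shape (`List.isChain_pump_iff`), the pumped factors are powers of letters of the three blocks
(`StratSyntax.eq_replicate_of_isChain_append_self`), and the pumped word is again the word of a test
formula (`StratSyntax.eq_testWord`).
-/

/-! ### Parse trees and Ogden's lemma -/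

namespace ContextFreeGrammar

variable {T S : Type*} {g : ContextFreeGrammar T} {π : S → T}

/-- The sentential form that consists of the images under `π` of the letters of `w`. -/
def letters (g : ContextFreeGrammar T) (π : S → T) (w : List S) : List (Symbol T g.NT) :=
  w.map fun s => Symbol.terminal (π s)

@[simp] lemma letters_nil : g.letters π [] = [] := rfl

@[simp] lemma letters_append (v w : List S) :
    g.letters π (v ++ w) = g.letters π v ++ g.letters π w := List.map_append

/-- `g.Parse π n a w` says that there is a parse tree of height at most `n`, with the symbol `a` at
the root, whose leaves spell the image under `π` of the word `w`. -/
def Parse (g : ContextFreeGrammar T) (π : S → T) : ℕ → Symbol T g.NT → List S → Prop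
  | 0, a, w => ∃ s, a = .terminal (π s) ∧ w = [s]
  | n + 1, a, w => Parse g π n a w ∨ ∃ r ∈ g.rules, a = .nonterminal r.input ∧
      ∃ ws, List.Forall₂ (Parse g π n) r.output ws ∧ w = ws.flatten

lemma Derives.append {u u' v v' : List (Symbol T g.NT)} (h : g.Derives u u')
    (h' : g.Derives v v') : g.Derives (u ++ v) (u' ++ v') :=
  (h.append_right v).trans (h'.append_left u')

lemma Derives.replace {α : List (Symbol T g.NT)} {b : Symbol T g.NT} {v β y : List (Symbol T g.NT)}
    (h : g.Derives α (v ++ [b] ++ y)) (hb : g.Derives [b] β) : g.Derives α (v ++ β ++ y) :=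
  h.trans ((hb.append_left v).append_right y)

lemma derives_flatten_of_forall₂ {α : List (Symbol T g.NT)} {ws : List (List S)}
    (h : List.Forall₂ (fun a w => g.Derives [a] (g.letters π w)) α ws) :
    g.Derives α (g.letters π ws.flatten) := by
  induction h with
  | nil => exact .refl _
  | cons h₁ _ ih => simpa using h₁.append ih

lemma derives_of_mem_rules {r : ContextFreeRule T g.NT} (hr : r ∈ g.rules) :
    g.Derives [.nonterminal r.input] r.output :=
  Produces.single ⟨r, hr, .input_output⟩

lemma Parse.derives {n : ℕ} {a : Symbol T g.NT} {w : List S} (h : g.Parse π n a w) :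
    g.Derives [a] (g.letters π w) := by
  induction n generalizing a w with
  | zero =>
    obtain ⟨s, rfl, rfl⟩ := h
    exact .refl _
  | succ n ih =>
    obtain h | ⟨r, hr, rfl, ws, hws, rfl⟩ := h
    · exact ih h
    · exact (derives_of_mem_rules hr).trans
        (derives_flatten_of_forall₂ (hws.imp fun _ _ h => ih h))

end ContextFreeGrammar

lemma List.Forall₂.exists_append {α β : Type*} {R : α → β → Prop} {l₁ l₂ : List α} {m : List β}
    (h : Forall₂ R (l₁ ++ l₂) m) : ∃ m₁ m₂, m = m₁ ++ m₂ ∧ Forall₂ R l₁ m₁ ∧ Forall₂ R l₂ m₂ := by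
  induction l₁ generalizing m with
  | nil => exact ⟨[], m, rfl, .nil, h⟩
  | cons a l ih =>
    cases h with
    | cons hab h =>
      obtain ⟨m₁, m₂, rfl, h₁, h₂⟩ := ih h
      exact ⟨_ :: m₁, m₂, rfl, .cons hab h₁, h₂⟩

namespace ContextFreeGrammar

variable {T S : Type*} {g : ContextFreeGrammar T} {π : S → T}

lemma Derives.exists_parse {α : List (Symbol T g.NT)} {w : List S}
    (h : g.Derives α (g.letters π w)) :
    ∃ n ws, List.Forall₂ (g.Parse π n) α ws ∧ w = ws.flatten := by
  induction h using Relation.ReflTransGen.head_induction_on with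
  | refl =>
    refine ⟨0, w.map fun s => [s], ?_, (List.flatMap_singleton' w).symm⟩
    exact List.forall₂_map_left_iff.2 (List.forall₂_map_right_iff.2
      (List.forall₂_same.2 fun s _ => ⟨s, rfl, rfl⟩))
  | head hαβ _ ih =>
    obtain ⟨n, ws, hws, rfl⟩ := ih
    obtain ⟨r, hr, hrew⟩ := hαβ
    obtain ⟨p, q, rfl, rfl⟩ := hrew.exists_parts
    obtain ⟨ws₁, ws₂, rfl, h₁, h₂⟩ := hws.exists_append
    obtain ⟨ws₀, ws₁, rfl, h₀, h₁⟩ := h₁.exists_append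
    have up : ∀ {a : Symbol T g.NT} {w : List S}, g.Parse π n a w → g.Parse π (n + 1) a w :=
      .inl
    refine ⟨n + 1, ws₀ ++ [ws₁.flatten] ++ ws₂, ?_, by simp⟩
    exact List.rel_append (List.rel_append (h₀.imp fun _ _ => up)
      (.cons (.inr ⟨r, hr, rfl, ws₁, h₁, rfl⟩) .nil)) (h₂.imp fun _ _ => up)

/-- A word derived from one of several sibling symbols sits inside the word derived from all. -/
lemma exists_context_of_mem {α : List (Symbol T g.NT)} {ws : List (List S)} {w : List S} {n : ℕ}
    (h : List.Forall₂ (g.Parse π n) α ws) (hw : w ∈ ws) :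
    ∃ a v y, g.Parse π n a w ∧ ws.flatten = v ++ w ++ y ∧
      g.Derives α (g.letters π v ++ [a] ++ g.letters π y) := by
  induction h with
  | nil => simp at hw
  | @cons a w' α ws hab h ih =>
    obtain rfl | hw := List.mem_cons.1 hw
    · refine ⟨a, [], ws.flatten, hab, by simp, ?_⟩
      simpa using (derives_flatten_of_forall₂ (h.imp fun _ _ h => h.derives)).append_left [a]
    · obtain ⟨b, v, y, hb, hws, hd⟩ := ih hw
      exact ⟨b, w' ++ v, y, hb, by simp [hws], by simpa using hab.derives.append hd⟩

/-- `g.Pumpable π c p a w`: the word `w` has a derivation from the symbol `a` in which some nonterminal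
`B` derives `v B y`, where `v y` contains a letter marked by `p`, and where the words below the two
occurrences of `B` have the same colour under `c`. -/
def Pumpable {C : Type*} (g : ContextFreeGrammar T) (π : S → T) (c : List S → C) (p : S → Bool)
    (a : Symbol T g.NT) (w : List S) : Prop :=
  ∃ (B : g.NT) (u v x y z : List S), w = u ++ (v ++ x ++ y) ++ z ∧
    g.Derives [a] (g.letters π u ++ [.nonterminal B] ++ g.letters π z) ∧
    g.Derives [.nonterminal B] (g.letters π v ++ [.nonterminal B] ++ g.letters π y) ∧
    g.Derives [.nonterminal B] (g.letters π x) ∧ 0 < (v ++ y).countP p ∧ c (v ++ x ++ y) = c x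

lemma Pumpable.context {C : Type*} {c : List S → C} {p : S → Bool} {a b : Symbol T g.NT}
    {v w y : List S} (h : g.Pumpable π c p b w)
    (hd : g.Derives [a] (g.letters π v ++ [b] ++ g.letters π y)) :
    g.Pumpable π c p a (v ++ w ++ y) := by
  obtain ⟨B, u, v', x, y', z, rfl, h₁, h⟩ := h
  exact ⟨B, v ++ u, v', x, y', z ++ y, by simp, by simpa using hd.replace h₁, h⟩

/-- The bound behind Ogden's lemma. Labels are pairs of a nonterminal and a colour, and `D` is to be
thought of as the set of labels that occur above `a` at nodes where marks branch off. If no such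
label is met again and no label repeats with a marked letter in between, then each new label
multiplies the number of marked letters by at most the length `b` of a rule. -/
lemma Parse.pumpable_or_countP_le {C : Type*} {c : List S → C} {p : S → Bool}
    [DecidableEq (g.NT × C)] {K : Finset (g.NT × C)} {b : ℕ} (hb : 0 < b)
    (hK : ∀ r ∈ g.rules, ∀ γ, (r.input, γ) ∈ K) (hrb : ∀ r ∈ g.rules, r.output.length ≤ b)
    (n : ℕ) (D : Finset (g.NT × C)) (a : Symbol T g.NT) (w : List S) (h : g.Parse π n a w) :
    g.Pumpable π c p a w ∨
      (∃ (B : g.NT) (v x y : List S), (B, c x) ∈ D ∧ w = v ++ x ++ y ∧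
        g.Derives [a] (g.letters π v ++ [.nonterminal B] ++ g.letters π y) ∧
        g.Derives [.nonterminal B] (g.letters π x)) ∨
      w.countP p ≤ b ^ (K \ D).card := by
  induction n generalizing D a w with
  | zero =>
    obtain ⟨s, rfl, rfl⟩ := h
    exact .inr (.inr (List.countP_le_length.trans (Nat.one_le_pow _ _ hb)))
  | succ n ih =>
    obtain h | h := h
    · exact ih D a w h
    have hder : g.Derives [a] (g.letters π w) := Parse.derives (n := n + 1) (.inr h)
    obtain ⟨r, hr, rfl, ws, hws, rfl⟩ := h
    by_cases hD : (r.input, c ws.flatten) ∈ D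
    · exact .inr (.inl ⟨r.input, [], ws.flatten, [], hD, by simp, .refl _, hder⟩)
    by_cases hsame : ∃ w ∈ ws, w.countP p = ws.flatten.countP p
    · -- all marks lie below one child: nothing branches off, and `D` stays as it is
      obtain ⟨w, hw, hcount⟩ := hsame
      obtain ⟨a, v, y, ha, hflat, hd⟩ := exists_context_of_mem hws hw
      replace hd := (derives_of_mem_rules hr).trans hd
      rw [← hcount, hflat]
      obtain hp | ⟨B, v', x, y', hB, rfl, h₁, h₂⟩ | hle := ih D a w ha
      · exact .inl (hp.context hd)
      · exact .inr (.inl ⟨B, v ++ v', x, y' ++ y, hB, by simp, by simpa using hd.replace h₁, h₂⟩)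
      · exact .inr (.inr hle)
    -- every child has fewer marks than the node: its label is added to `D`
    have hlt : ∀ w ∈ ws, w.countP p < ws.flatten.countP p := fun w hw =>
      lt_of_le_of_ne ((List.sublist_flatten_of_mem hw).countP_le)
        fun h => hsame ⟨w, hw, h⟩
    by_cases hall : ∀ w ∈ ws, w.countP p ≤ b ^ (K \ insert (r.input, c ws.flatten) D).card
    · refine .inr (.inr ?_)
      have hcard : (K \ D).card = (K \ insert (r.input, c ws.flatten) D).card + 1 := by
        rw [Finset.sdiff_insert, Finset.card_erase_add_one]
        exact Finset.mem_sdiff.2 ⟨hK r hr _, hD⟩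
      rw [List.countP_flatten, hcard, pow_succ']
      refine (List.sum_le_card_nsmul _ _ (List.forall_mem_map.2 hall)).trans ?_
      rw [List.length_map, ← hws.length_eq, smul_eq_mul]
      exact Nat.mul_le_mul_right _ (hrb r hr)
    push Not at hall
    obtain ⟨w, hw, hgt⟩ := hall
    obtain ⟨a, v, y, ha, hflat, hd⟩ := exists_context_of_mem hws hw
    replace hd := (derives_of_mem_rules hr).trans hd
    obtain hp | ⟨B, v', x, y', hB, rfl, h₁, h₂⟩ | hle := ih (insert (r.input, c ws.flatten) D) a w ha
    · exact .inl (hflat ▸ hp.context hd)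
    · have hd' : g.Derives [.nonterminal r.input]
          (g.letters π (v ++ v') ++ [.nonterminal B] ++ g.letters π (y' ++ y)) := by
        simpa using hd.replace h₁
      obtain hB | hB := Finset.mem_insert.1 hB
      · obtain ⟨rfl, hc⟩ := Prod.mk.inj hB
        refine .inl ⟨r.input, [], v ++ v', x, y' ++ y, [], by simp [hflat], .refl _, hd', h₂, ?_, ?_⟩
        · have := hlt _ hw
          simp only [hflat, List.countP_append] at this ⊢
          omega
        · rw [hc, hflat]; simp
      · exact .inr (.inl ⟨B, v ++ v', x, y' ++ y, hB, by simp [hflat], hd', h₂⟩)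
    · exact absurd hle hgt.not_ge

/-- **Ogden's lemma**, with a colouring of words by finitely many colours. In a word of a
context-free language with sufficiently many marked letters, a marked letter can be pumped in such
a way that the middle part keeps its colour. The marks are put on the letters of a larger alphabet
`S`, in which the occurrences of a letter of `T` can be told apart. -/
theorem exists_pump {C : Type*} [Finite C] (g : ContextFreeGrammar T) (π : S → T)
    (c : List S → C) (p : S → Bool) :
    ∃ N, ∀ w : List S, w.map π ∈ g.language → N < w.countP p → ∃ u v x y z : List S,
      w = u ++ (v ++ x ++ y) ++ z ∧ 0 < (v ++ y).countP p ∧ c (v ++ x ++ y) = c x ∧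
      ∀ k, (u ++ ((List.replicate k v).flatten ++ x ++ (List.replicate k y).flatten) ++ z).map π ∈
        g.language := by
  classical
  have := Fintype.ofFinite C
  set K : Finset (g.NT × C) := g.rules.image (·.input) ×ˢ Finset.univ
  set b := g.rules.sup (·.output.length) + 1
  refine ⟨b ^ (K \ ∅).card, fun w hw hN => ?_⟩
  have hw' : g.Derives [.nonterminal g.initial] (g.letters π w) := by
    simpa [letters, Function.comp_def] using hw
  obtain ⟨n, ws, hws, rfl⟩ := hw'.exists_parse
  obtain ⟨w, l, h, hnil, rfl⟩ := List.forall₂_cons_left_iff.1 hws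
  obtain rfl := List.forall₂_nil_left_iff.1 hnil
  simp only [List.flatten_cons, List.flatten_nil, List.append_nil] at hN ⊢
  obtain ⟨B, u, v, x, y, z, rfl, h₁, h₂, h₃, h₄⟩ | ⟨_, _, _, _, hmem, _⟩ | hle :=
    h.pumpable_or_countP_le (c := c) (p := p) (K := K) (b := b) (Nat.succ_pos _)
      (fun r hr γ => Finset.mem_product.2 ⟨Finset.mem_image_of_mem _ hr, Finset.mem_univ _⟩)
      (fun r hr => (Finset.le_sup (f := (·.output.length)) hr).trans (Nat.le_succ _)) n ∅
  · refine ⟨u, v, x, y, z, rfl, h₄.1, h₄.2, fun k => ?_⟩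
    have hB : g.Derives [.nonterminal B]
        (g.letters π ((List.replicate k v).flatten ++ x ++ (List.replicate k y).flatten)) := by
      induction k with
      | zero => simpa using h₃
      | succ k ih =>
        rw [List.replicate_succ, List.replicate_succ']
        simpa using h₂.replace ih
    have := h₁.replace hB
    simpa [letters, Function.comp_def] using this
  · simp at hmem
  · exact absurd hle hN.not_ge

end ContextFreeGrammar

/-! ### Pumping and local conditions on words -/

namespace List

/-- A word that is a chain for a local relation between neighbours remains a chain if a factor is
replaced by one with the same first letter, the same last letter and the same chain property. -/
lemma isChain_replace_iff {α : Type*} {r : α → α → Prop} {x x' : List α}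
    (h : (IsChain r x, x.head?, x.getLast?) = (IsChain r x', x'.head?, x'.getLast?))
    (u z : List α) : IsChain r (u ++ x ++ z) ↔ IsChain r (u ++ x' ++ z) := by
  simp only [Prod.mk.injEq] at h
  simp only [isChain_append, getLast?_append, h.1, h.2.1, h.2.2]

/-- Pumping preserves chains if the middle factor keeps its first letter, its last letter and its
chain property. -/
lemma isChain_pump_iff {α : Type*} {r : α → α → Prop} {v x y : List α}
    (h : (IsChain r (v ++ x ++ y), (v ++ x ++ y).head?, (v ++ x ++ y).getLast?) =
      (IsChain r x, x.head?, x.getLast?)) (u z : List α) (k : ℕ) :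
    IsChain r (u ++ ((replicate k v).flatten ++ x ++ (replicate k y).flatten) ++ z) ↔
      IsChain r (u ++ x ++ z) := by
  induction k with
  | zero => simp
  | succ k ih =>
    have := isChain_replace_iff h (u ++ (replicate k v).flatten) ((replicate k y).flatten ++ z)
    rw [replicate_succ', replicate_succ (a := y)]
    simp only [flatten_append, flatten_cons, flatten_nil, append_nil, append_assoc] at this ih ⊢
    exact this.trans ih

end List

/-! ### Formulae with three variable blocks of primes -/

namespace StratSyntax

open List

/-- The formula `[x ∈ w → [w ∈ y → w ∈ z]]`, where `x`, `y`, `z` are the variables with `i`, `j`,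
`k` primes. -/
def testFormula (i j k : ℕ) : Formula :=
  .imp (.mem i 0) (.imp (.mem 0 j) (.mem 0 k))

/-- The stratification is `-1` at the first variable, `0` at `w` and `1` elsewhere. -/
lemma testFormula_isStratified {i j k : ℕ} (hi : i ≠ 0) (hj : j ≠ 0) (hk : k ≠ 0) (hij : j ≠ i)
    (hik : k ≠ i) : (testFormula i j k).IsStratified := by
  refine ⟨fun n => if n = i then -1 else if n = 0 then 0 else 1, ?_, ?_⟩
  · rintro x y h
    simp only [testFormula, Formula.subformulae, Set.mem_union, Set.mem_singleton_iff,
      Formula.mem.injEq, reduceCtorEq, false_or] at h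
    obtain ⟨rfl, rfl⟩ | ⟨rfl, rfl⟩ | ⟨rfl, rfl⟩ := h <;> simp [*, hi.symm]
  · rintro x y h
    simp [testFormula, Formula.subformulae] at h

lemma not_testFormula_isStratified {i j k : ℕ} (h : i = j ∨ i = k) :
    ¬ (testFormula i j k).IsStratified := by
  rintro ⟨σ, hσ, -⟩
  have h₁ := hσ i 0 (by simp [testFormula, Formula.subformulae])
  have h₂ := hσ 0 j (by simp [testFormula, Formula.subformulae])
  have h₃ := hσ 0 k (by simp [testFormula, Formula.subformulae])
  obtain rfl | rfl := h <;> omega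

/-- The symbol at each of the eighteen positions in the string of a test formula, where each of the
three blocks of primes counts as one position, namely `2`, `10` and `15`. -/
def symbAt : Fin 18 → Symb :=
  ![.lbr, .w, .prime, .mem, .w, .imp, .lbr, .w, .mem, .w, .prime, .imp, .w, .mem, .w, .prime,
    .rbr, .rbr]

/-- The string of a test formula, written in the alphabet of positions. -/
def testWord (i j k : ℕ) : List (Fin 18) :=
  [0, 1] ++ replicate i 2 ++ [3, 4, 5, 6, 7, 8, 9] ++ replicate j 10 ++ [11, 12, 13, 14] ++
    replicate k 15 ++ [16, 17]

lemma map_symbAt_testWord (i j k : ℕ) : (testWord i j k).map symbAt = (testFormula i j k).str := by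
  simp [testWord, testFormula, Formula.str, varStr, symbAt]

lemma map_symbAt_testWord_mem {i j k : ℕ} :
    (testWord i j k).map symbAt ∈ stratifiedLanguage ↔ (testFormula i j k).IsStratified := by
  rw [map_symbAt_testWord]
  exact ⟨fun ⟨φ, hφ, h⟩ => Formula.str_injective h ▸ hφ, fun h => ⟨_, h, rfl⟩⟩

/-- Position `t` may follow position `s` in the string of a test formula. -/
def Follows (s t : Fin 18) : Prop := t.val = s.val + 1 ∨ s = t ∧ (s = 2 ∨ s = 10 ∨ s = 15)

instance : DecidableRel Follows := fun _ _ => inferInstanceAs (Decidable (_ ∨ _))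

lemma Follows.le {s t : Fin 18} (h : Follows s t) : s ≤ t := by
  obtain h | ⟨rfl, -⟩ := h
  · exact Fin.le_def.2 (by omega)
  · exact le_rfl

lemma isChain_follows_testWord {i j k : ℕ} (hi : i ≠ 0) (hj : j ≠ 0) (hk : k ≠ 0) :
    IsChain Follows (testWord i j k) := by
  have hrep (n : ℕ) {s : Fin 18} (h : Follows s s) : IsChain Follows (replicate n s) :=
    isChain_replicate_of_rel n h
  suffices IsChain Follows (replicate i 2) ∧ IsChain Follows (replicate j 10) ∧
      IsChain Follows (replicate k 15) by
    simpa [testWord, isChain_append, isChain_cons, head?_replicate, getLast?_replicate, hi, hj, hk,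
      Follows] using this
  exact ⟨hrep _ (by decide), hrep _ (by decide), hrep _ (by decide)⟩

lemma pairwise_le_of_isChain_follows {w : List (Fin 18)} (h : IsChain Follows w) :
    w.Pairwise (· ≤ ·) :=
  isChain_iff_pairwise.1 (h.imp fun _ _ => Follows.le)

lemma pairwise_le_testWord (i j k : ℕ) : (testWord i j k).Pairwise (· ≤ ·) := by
  simp [testWord, pairwise_append, pairwise_replicate, or_imp, forall_and]

/-- Only letters of one and the same block can be repeated. -/
lemma eq_replicate_of_isChain_append_self {v : List (Fin 18)} (h : IsChain Follows (v ++ v)) :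
    ∃ n s, v = replicate n s ∧ (s = 2 ∨ s = 10 ∨ s = 15) := by
  obtain _ | ⟨a, l⟩ := v
  · exact ⟨0, 2, rfl, .inl rfl⟩
  obtain ⟨hle, -, hle'⟩ := pairwise_append.1 (pairwise_le_of_isChain_follows h)
  have hv : a :: l = replicate (l.length + 1) a := by
    refine eq_replicate_iff.2 ⟨rfl, fun b hb => ?_⟩
    refine le_antisymm (hle' b hb a mem_cons_self) ?_
    obtain rfl | hb := mem_cons.1 hb
    · exact le_rfl
    · exact (pairwise_cons.1 hle).1 b hb
  refine ⟨_, a, hv, ?_⟩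
  rw [hv, replicate_append_replicate, show l.length + 1 + (l.length + 1) = l.length + l.length + 2
    by omega, replicate_succ, replicate_succ, isChain_cons_cons] at h
  obtain h | h := h.1
  · omega
  · exact h.2

lemma count_testWord (i j k : ℕ) (s : Fin 18) : (testWord i j k).count s =
    (testWord 0 0 0).count s + ((if s = 2 then i else 0) + (if s = 10 then j else 0) +
      (if s = 15 then k else 0)) := by
  simp only [testWord, count_append, count_replicate, beq_iff_eq, eq_comm (b := s)]
  split_ifs <;> omega

/-- A chain is sorted, hence determined by how often each position occurs in it. -/
lemma eq_testWord {w v : List (Fin 18)} {i j k m : ℕ} (hw : IsChain Follows w)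
    (hv : ∀ s ∈ v, s = 2 ∨ s = 10 ∨ s = 15)
    (h : ∀ s, w.count s = (testWord i j k).count s + m * v.count s) :
    w = testWord (i + m * v.count 2) (j + m * v.count 10) (k + m * v.count 15) := by
  refine Perm.eq_of_pairwise' (pairwise_le_of_isChain_follows hw) (pairwise_le_testWord _ _ _)
    (perm_iff_count.2 fun s => ?_)
  rw [h, count_testWord, count_testWord (i + _)]
  by_cases hs : s = 2 ∨ s = 10 ∨ s = 15
  · obtain rfl | rfl | rfl := hs <;> simp <;> omega
  · rw [count_eq_zero_of_not_mem fun hmem => hs (hv s hmem)]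
    simp only [not_or] at hs
    simp [hs]

end StratSyntax

open StratSyntax List in
theorem theorem4p1 : ¬ StratSyntax.stratifiedLanguage.IsContextFree := by
  rintro ⟨g, hg⟩
  obtain ⟨N, hN⟩ := g.exists_pump symbAt
    (fun x => (IsChain Follows x, x.head?, x.getLast?)) (· == 2)
  rw [hg] at hN
  have hfac := (N + 1).factorial_pos
  obtain ⟨u, v, x, y, z, hw, hpos, hcol, hpump⟩ :=
    hN (testWord (N + 1) (N + 1 + (N + 1).factorial) (N + 1 + 2 * (N + 1).factorial))
      (map_symbAt_testWord_mem.2 (testFormula_isStratified (by omega) (by omega) (by omega)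
        (by omega) (by omega)))
      (by change N < count 2 _; rw [count_testWord]; simp; omega)
  change 0 < count 2 _ at hpos
  -- pumping does not change the shape of the word
  have hchain (m : ℕ) :
      IsChain Follows (u ++ ((replicate m v).flatten ++ x ++ (replicate m y).flatten) ++ z) := by
    rw [isChain_pump_iff hcol, ← isChain_replace_iff hcol, ← hw]
    exact isChain_follows_testWord (by omega) (by omega) (by omega)
  obtain ⟨n, s, rfl, hs⟩ := eq_replicate_of_isChain_append_self
    ((hchain 2).infix (l₁ := v ++ v) ⟨u, x ++ y ++ y ++ z, by simp [replicate_succ]⟩)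
  obtain ⟨n', t, rfl, ht⟩ := eq_replicate_of_isChain_append_self
    ((hchain 2).infix (l₁ := y ++ y) ⟨u ++ replicate n s ++ replicate n s ++ x, z,
      by simp [replicate_succ]⟩)
  set d := replicate n s ++ replicate n' t with hd
  have hdS : ∀ a ∈ d, a = 2 ∨ a = 10 ∨ a = 15 := by
    intro a ha
    obtain ha | ha := mem_append.1 ha
    · exact eq_of_mem_replicate ha ▸ hs
    · exact eq_of_mem_replicate ha ▸ ht
  -- a word of the right shape is determined by its letter counts
  have heq (m : ℕ) := eq_testWord (m := m) (hchain (m + 1)) hdS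
    (i := N + 1) (j := N + 1 + (N + 1).factorial) (k := N + 1 + 2 * (N + 1).factorial) fun a => by
      rw [hw]
      simp only [hd, count_append, count_flatten, map_replicate, sum_replicate, smul_eq_mul]
      ring
  have hunstrat (m : ℕ) := map_symbAt_testWord_mem.1 (heq m ▸ hpump (m + 1))
  have hle : d.count 2 ≤ N + 1 := by
    have := congrArg (count 2) hw
    rw [count_testWord] at this
    simp [testWord, hd, count_append] at this ⊢
    omega
  obtain ⟨q, hq⟩ := Nat.dvd_factorial hpos hle
  -- one of the two pumped factors lies in the first block, so that the other one misses the second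
  -- or the third block; the first block can be pumped to the length of a block that stays fixed
  have hzero : d.count 10 = 0 ∨ d.count 15 = 0 := by
    simp only [hd, count_append, count_replicate] at hpos ⊢
    obtain rfl | rfl | rfl := hs <;> obtain rfl | rfl | rfl := ht <;> simp at hpos ⊢
  obtain h | h := hzero
  · refine not_testFormula_isStratified (.inl ?_) (hunstrat q)
    rw [h, hq]; ring
  · refine not_testFormula_isStratified (.inr ?_) (hunstrat (2 * q))
    rw [h, hq]; ring
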